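/- An MTL-algebra is a prelinear, commutative, bounded, integral residuated lattice $(A,*,\Rightarrow,\sqcap,\sqcup,0,1)$; put $\sim x := x\Rightarrow 0$. A BL-algebra is an MTL-algebra satisfying $x\sqcap y = x*(x\Rightarrow y)$, and an MV-algebra is a BL-algebra satisfying $\sim\sim x = x$. A chain is a totally ordered algebra. A variety of BL-algebras is a class of BL-algebras axiomatized by equations in the language $\{*,\Rightarrow,\sqcap,\sqcup,0,1\}$. For a variety $\mathbb{L}$ of BL-algebras let $\mathbb{L}_\Delta$ be the class of all algebras in $\mathbb{L}$ expanded by a unary operation $\Delta$ with $\Delta 1 = 1$ and, for all $x,y$, $$\Delta x\sqcup\sim\Delta x = 1,\qquad \Delta x\Rightarrow x = 1,\qquad \Delta x\Rightarrow\Delta\Delta x = 1,$$ $$\Delta(x\Rightarrow y)\Rightarrow(\Delta x\Rightarrow\Delta y) = 1,\qquad \Delta(x\sqcup y)\Rightarrow(\Delta x\sqcup\Delta y) = 1.$$ We say that $\mathbb{L}$ coincides with $\mathbb{L}_\Delta$ (that is, $\mathbb{L}$ defines $\Delta$) if there is a unary term $t$ in the language $\{*,\Rightarrow,\sqcap,\sqcup,0,1\}$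 such that the algebras in $\mathbb{L}_\Delta$ are exactly the algebras in $\mathbb{L}$ expanded by $\Delta x := t(x)$. Corollary. A variety $\mathbb{L}$ of BL-algebras coincides with $\mathbb{L}_\Delta$ if and only if it is a variety of MV-algebras generated by a finite (possibly empty) set of finite MV-chains, i.e. all members of $\mathbb{L}$ are MV-algebras and $\mathbb{L}$ is the smallest variety of BL-algebras containing some such set. -/

import Mathlib

universe u v

/-- MTL-algebras `(A, *, ⇨, ⊓, ⊔, ⊥, 1)`: prelinear, commutative, bounded, integral residuated
lattices. The unit `1` of the monoid is the top element. -/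
class MTLAlgebra (A : Type u) extends Lattice A, OrderBot A, CommMonoid A, HImp A where
  le_unit : ∀ a : A, a ≤ 1
  residuation : ∀ a b c : A, a * b ≤ c ↔ a ≤ b ⇨ c
  prelinear : ∀ a b : A, (a ⇨ b) ⊔ (b ⇨ a) = 1

/-- The negation `∼ a = a ⇨ ⊥` of an MTL-algebra. -/
def mtlNeg {A : Type u} [MTLAlgebra A] (a : A) : A := a ⇨ ⊥

/-- BL-algebras: divisible MTL-algebras. -/
class BLAlgebra (A : Type u) extends MTLAlgebra A where
  divisible : ∀ a b : A, a ⊓ b = a * (a ⇨ b)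

/-- A BL-algebra is an MV-algebra if its negation is involutive. -/
def IsMVAlgebra (A : Type u) [BLAlgebra A] : Prop :=
  ∀ a : A, mtlNeg (mtlNeg a) = a

/-- An MV-chain is a totally ordered MV-algebra. -/
def IsMVChain (A : Type u) [BLAlgebra A] : Prop :=
  IsMVAlgebra A ∧ ∀ a b : A, a ≤ b ∨ b ≤ a

/-- Terms in the language of MTL-algebras with variables from `X`. -/
inductive MTLTerm (X : Type v) : Type v
  | var : X → MTLTerm X
  | bot : MTLTerm X
  | one : MTLTerm X
  | mul : MTLTerm X → MTLTerm X → MTLTerm X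
  | imp : MTLTerm X → MTLTerm X → MTLTerm X
  | inf : MTLTerm X → MTLTerm X → MTLTerm X
  | sup : MTLTerm X → MTLTerm X → MTLTerm X

/-- The value of a term in an MTL-algebra under an assignment of the variables. -/
def MTLTerm.eval {X : Type v} {A : Type u} [MTLAlgebra A] (e : X → A) : MTLTerm X → A
  | .var x => e x
  | .bot => ⊥
  | .one => 1
  | .mul s t => s.eval e * t.eval e
  | .imp s t => s.eval e ⇨ t.eval e
  | .inf s t => s.eval e ⊓ t.eval e
  | .sup s t => s.eval e ⊔ t.eval e

/-- Bundled BL-algebras. -/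
structure BLAlg : Type (u + 1) where
  carrier : Type u
  [str : BLAlgebra carrier]

attribute [instance] BLAlg.str

/-- The class of all BL-algebras that satisfy every equation `p.1 = p.2` with `p ∈ E`. -/
def BLAlg.models (E : Set (MTLTerm ℕ × MTLTerm ℕ)) : Set BLAlg.{u} :=
  {A | ∀ p ∈ E, ∀ e : ℕ → A.carrier, p.1.eval e = p.2.eval e}

/-- A variety of BL-algebras: a class of BL-algebras axiomatized by equations. -/
def IsBLVariety (L : Set BLAlg.{u}) : Prop :=
  ∃ E : Set (MTLTerm ℕ × MTLTerm ℕ), L = BLAlg.models E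

/-- The variety generated by a class of BL-algebras: the smallest variety that contains it. -/
def varietyGeneratedBy (K : Set BLAlg.{u}) : Set BLAlg.{u} :=
  ⋂₀ {V | IsBLVariety V ∧ K ⊆ V}

/-- The identities for the projection operator `Δ`. The first five correspond to the axiom
schemes of the expansion by `Δ`; the last one corresponds to its necessitation rule
(from `φ` infer `Δ φ`), without which the constant `⊥` operation would be allowed. -/
structure IsDelta {A : Type u} [MTLAlgebra A] (δ : A → A) : Prop where
  excluded_middle : ∀ a, δ a ⊔ mtlNeg (δ a) = 1
  reflexive : ∀ a, δ a ⇨ a = 1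
  transitive : ∀ a, δ a ⇨ δ (δ a) = 1
  imp : ∀ a b, δ (a ⇨ b) ⇨ (δ a ⇨ δ b) = 1
  sup : ∀ a b, δ (a ⊔ b) ⇨ (δ a ⊔ δ b) = 1
  necessitation : δ 1 = 1

/-- BL-algebras equipped with an additional unary operation. -/
abbrev BLAlgWithOp : Type (u + 1) := Σ A : BLAlg.{u}, (A.carrier → A.carrier)

/-- The class `L_Δ`: the members of `L` expanded by an operation satisfying the identities
for `Δ`. -/
def deltaExpansion (L : Set BLAlg.{u}) : Set BLAlgWithOp.{u} :=
  {P | P.1 ∈ L ∧ IsDelta P.2}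

/-- The expansion of the members of `L` by the unary operation that the term `t` defines. -/
def termExpansion (t : MTLTerm Unit) (L : Set BLAlg.{u}) : Set BLAlgWithOp.{u} :=
  {P | P.1 ∈ L ∧ P.2 = fun a => t.eval (fun _ => a)}

/-- `L` coincides with `L_Δ`, that is, `Δ` is definable in `L`: for some unary term `t` in the
language of MTL-algebras, the algebras in `L_Δ` are exactly the algebras in `L` with `Δ`
interpreted by `t`. -/
def CoincidesWithDelta (L : Set BLAlg.{u}) : Prop :=
  ∃ t : MTLTerm Unit, deltaExpansion L = termExpansion t L

/-! In any algebra at most one `Δ` exists, since `Δ a` is the largest complemented element below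
`a`. So the claim becomes: some unary term satisfies the `Δ` identities throughout the variety
(`coincidesWithDelta_iff`).

Suppose `t` does. By a Glivenko argument, the double negation of `t a` depends only on that of `a`;
as `t a` is complemented, `t a = 1` for every dense `a`, whence `a = 1`. Since `∼∼a ⇨ a` is always
dense, negation is involutive. On MV-chains every unary term agrees near `1` with a power or a
negated power (`HasPowGerm.eval`), whereas `t` drops from `1` to `⊥` immediately below `1`. This
bounds nilpotency orders, hence the sizes of the chains (`IsMVChain.finset_card_le`). Up to
isomorphism finitely many chains remain, and they generate the variety because prime filter
quotients separate points.

Conversely, if `n` bounds the sizes of the generating chains, `a ^ n` is `Δ` on each of them. Being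
`Δ` is equational, so this passes to the generated variety. -/

namespace MTLAlgebra

/-! ### Arithmetic of MTL-algebras -/

variable {A : Type u} [MTLAlgebra A] {a b c d : A}

theorem le_himp_iff_mul_le : a ≤ b ⇨ c ↔ a * b ≤ c := (residuation a b c).symm

theorem mul_le_mul_of_le (h : a ≤ b) (c : A) : a * c ≤ b * c :=
  (residuation _ _ _).2 (h.trans ((residuation _ _ _).1 le_rfl))

instance : IsOrderedMonoid A where
  mul_le_mul_left _ _ h c := mul_le_mul_of_le h c

theorem mul_le_left (a b : A) : a * b ≤ a := mul_le_of_le_one_right' (le_unit b)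

theorem mul_le_right (a b : A) : a * b ≤ b := mul_le_of_le_one_left' (le_unit a)

theorem eq_one_of_le (h : 1 ≤ a) : a = 1 := le_antisymm (le_unit a) h

theorem himp_eq_one : a ⇨ b = 1 ↔ a ≤ b := by
  constructor
  · intro h
    simpa using le_himp_iff_mul_le.1 h.ge
  · intro h
    exact eq_one_of_le (le_himp_iff_mul_le.2 (by simpa using h))

theorem himp_mul_le (a b : A) : (a ⇨ b) * a ≤ b := le_himp_iff_mul_le.1 le_rfl

theorem mul_himp_le (a b : A) : a * (a ⇨ b) ≤ b := mul_comm a (a ⇨ b) ▸ himp_mul_le a b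

theorem himp_mono (h : a ≤ b) (h' : c ≤ d) : b ⇨ c ≤ a ⇨ d :=
  le_himp_iff_mul_le.2 ((mul_le_mul_right h _).trans ((himp_mul_le b c).trans h'))

theorem one_himp (a : A) : (1 : A) ⇨ a = a :=
  le_antisymm (by simpa using himp_mul_le 1 a) (le_himp_iff_mul_le.2 (by simp))

theorem mul_himp (a b c : A) : a * b ⇨ c = a ⇨ (b ⇨ c) := by
  refine eq_of_forall_le_iff fun x => ?_
  simp only [le_himp_iff_mul_le, mul_assoc]

theorem mul_sup_le (h : a * b ≤ d) (h' : a * c ≤ d) : a * (b ⊔ c) ≤ d := by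
  rw [mul_comm, ← le_himp_iff_mul_le]
  exact sup_le (le_himp_iff_mul_le.2 (by rwa [mul_comm])) (le_himp_iff_mul_le.2 (by rwa [mul_comm]))

/-- Expand `(a ⊔ b) * (a ⊔ c)`: every product except `b * c` lies below `a`. Iterated, this carries
prelinearity over to powers, as the prime filter argument needs. -/
theorem sup_mul_eq_one (h : a ⊔ b = 1) (h' : a ⊔ c = 1) : a ⊔ b * c = 1 := by
  apply eq_one_of_le
  calc (1 : A) = (a ⊔ b) * (a ⊔ c) := by rw [h, h', one_mul]
    _ ≤ a ⊔ b * c := by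
      refine mul_sup_le ((mul_le_right _ _).trans le_sup_left) ?_
      rw [mul_comm]
      exact mul_sup_le ((mul_le_right _ _).trans le_sup_left) (by rw [mul_comm]; exact le_sup_right)

theorem sup_pow_eq_one (h : a ⊔ b = 1) (n : ℕ) : a ⊔ b ^ n = 1 := by
  induction n with
  | zero => simpa using le_unit a
  | succ n ih => rw [pow_succ]; exact sup_mul_eq_one ih h

theorem pow_sup_pow_eq_one (h : a ⊔ b = 1) (m n : ℕ) : a ^ m ⊔ b ^ n = 1 := by
  rw [sup_comm]
  exact sup_pow_eq_one (by rw [sup_comm]; exact sup_pow_eq_one h n) m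

theorem pow_antitone (a : A) {m n : ℕ} (h : m ≤ n) : a ^ n ≤ a ^ m := by
  obtain ⟨k, rfl⟩ := Nat.exists_eq_add_of_le h
  rw [pow_add]
  exact mul_le_left _ _

theorem pow_ne_bot_of_le {m n : ℕ} (h : a ^ n ≠ ⊥) (hmn : m ≤ n) : a ^ m ≠ ⊥ := fun h' =>
  h (le_bot_iff.1 (h' ▸ pow_antitone a hmn))

theorem le_neg_iff : a ≤ mtlNeg b ↔ a * b = ⊥ := by
  rw [mtlNeg, le_himp_iff_mul_le, le_bot_iff]

theorem le_neg_comm : a ≤ mtlNeg b ↔ b ≤ mtlNeg a := by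
  rw [le_neg_iff, le_neg_iff, mul_comm]

theorem mul_neg_self (a : A) : a * mtlNeg a = ⊥ := le_bot_iff.1 (mul_himp_le a ⊥)

theorem neg_anti (h : a ≤ b) : mtlNeg b ≤ mtlNeg a := himp_mono h le_rfl

theorem le_neg_neg (a : A) : a ≤ mtlNeg (mtlNeg a) := le_neg_comm.1 le_rfl

theorem neg_neg_neg (a : A) : mtlNeg (mtlNeg (mtlNeg a)) = mtlNeg a :=
  le_antisymm (neg_anti (le_neg_neg a)) (le_neg_neg _)

theorem mtlNeg_one : mtlNeg (1 : A) = ⊥ := one_himp _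

theorem mtlNeg_bot : mtlNeg (⊥ : A) = 1 := himp_eq_one.2 le_rfl

theorem mtlNeg_mul (a b : A) : mtlNeg (a * b) = a ⇨ mtlNeg b := mul_himp a b ⊥

theorem mtlNeg_sup (a b : A) : mtlNeg (a ⊔ b) = mtlNeg a ⊓ mtlNeg b := by
  refine eq_of_forall_le_iff fun x => ?_
  rw [le_inf_iff, le_neg_comm, sup_le_iff, le_neg_comm, le_neg_comm (a := b)]

theorem himp_neg_neg (a b : A) : mtlNeg (mtlNeg a) ⇨ mtlNeg b = a ⇨ mtlNeg b := by
  rw [← mtlNeg_mul, ← mtlNeg_mul, mul_comm, mtlNeg_mul, neg_neg_neg, mul_comm a, mtlNeg_mul]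

theorem eq_bot_of_neg_eq_one (h : mtlNeg a = 1) : a = ⊥ := le_bot_iff.1 (himp_eq_one.1 h)

/-- Complemented elements are regular. -/
theorem neg_neg_eq_of_sup_neg (h : a ⊔ mtlNeg a = 1) : mtlNeg (mtlNeg a) = a := by
  refine le_antisymm ?_ (le_neg_neg a)
  calc mtlNeg (mtlNeg a) = mtlNeg (mtlNeg a) * (a ⊔ mtlNeg a) := by rw [h, mul_one]
    _ ≤ a := mul_sup_le (mul_le_right _ _) (by rw [mul_comm, mul_neg_self]; exact bot_le)

/-- In a chain, the only joins equal to `1` are the trivial ones. -/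
theorem eq_one_or_of_sup (htot : ∀ a b : A, a ≤ b ∨ b ≤ a) (h : a ⊔ b = 1) : a = 1 ∨ b = 1 := by
  rcases htot a b with h' | h'
  · right; rwa [sup_eq_right.2 h'] at h
  · left; rwa [sup_eq_left.2 h'] at h

end MTLAlgebra

/-! ### Uniqueness of `Δ` -/

namespace IsDelta

open MTLAlgebra

variable {A : Type u} [MTLAlgebra A] {δ ε : A → A}

theorem le (h : IsDelta δ) (a : A) : δ a ≤ a := himp_eq_one.1 (h.reflexive a)

theorem mono (h : IsDelta δ) {a b : A} (hab : a ≤ b) : δ a ≤ δ b := by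
  have := h.imp a b
  rwa [himp_eq_one.2 hab, h.necessitation, one_himp, himp_eq_one] at this

/-- Applying `δ` to `hb` gives `δ b ⊔ ∼b = 1`; multiplying by `b` kills the second term. -/
theorem le_of_sup_neg (h : IsDelta δ) {b : A} (hb : b ⊔ mtlNeg b = 1) : b ≤ δ b := by
  have h1 : δ b ⊔ mtlNeg b = 1 := by
    apply eq_one_of_le
    have := h.sup b (mtlNeg b)
    rw [hb, h.necessitation, one_himp] at this
    exact this.ge.trans (sup_le_sup_left (h.le _) _)
  calc b = b * (δ b ⊔ mtlNeg b) := by rw [h1, mul_one]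
    _ ≤ δ b := mul_sup_le (mul_le_right _ _) (by rw [mul_neg_self]; exact bot_le)

/-- `δ a` is the largest complemented element below `a`, so `δ` is determined by the algebra. -/
theorem unique (h : IsDelta δ) (h' : IsDelta ε) : δ = ε := by
  funext a
  exact le_antisymm
    ((h'.le_of_sup_neg (h.excluded_middle a)).trans (h'.mono (h.le a)))
    ((h.le_of_sup_neg (h'.excluded_middle a)).trans (h.mono (h'.le a)))

theorem eq_bot_of_ne_one (h : IsDelta δ) (htot : ∀ a b : A, a ≤ b ∨ b ≤ a) {a : A}
    (ha : a ≠ 1) : δ a = ⊥ := by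
  rcases eq_one_or_of_sup htot (h.excluded_middle a) with h1 | h1
  · exact absurd (eq_one_of_le (h1 ▸ h.le a)) ha
  · exact eq_bot_of_neg_eq_one h1

end IsDelta

/-! ### Double negation in BL-algebras -/

namespace BLAlgebra

open MTLAlgebra

variable {A : Type u} [BLAlgebra A]

theorem mul_himp_of_le {a b : A} (h : b ≤ a) : a * (a ⇨ b) = b := by
  rw [← divisible, inf_eq_right.2 h]

/-- Divisibility gives `∼∼a * d = a`, hence `d ⇨ ∼a = ∼a` and then `d * ∼a = ∼a`. As `∼d ≤ ∼a`,
divisibility again writes `∼d` as `∼a * ∼(∼a * d) = ∼a * ∼∼a = ⊥`. -/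
theorem neg_neg_himp_self_dense (a : A) :
    mtlNeg (mtlNeg (mtlNeg (mtlNeg a) ⇨ a)) = 1 := by
  set d := mtlNeg (mtlNeg a) ⇨ a with hd
  have h1 : d ⇨ mtlNeg a = mtlNeg a := by
    rw [← neg_neg_neg a, ← mtlNeg_mul, mul_comm, mul_himp_of_le (le_neg_neg a), neg_neg_neg]
  have h2 : d * mtlNeg a = mtlNeg a := by
    have h3 : mtlNeg a ≤ d := by
      rw [hd, le_himp_iff_mul_le, mul_neg_self]
      exact bot_le
    conv_rhs => rw [← mul_himp_of_le h3, h1]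
  have h4 : mtlNeg d ≤ mtlNeg a :=
    neg_anti (le_himp_iff_mul_le.2 (mul_le_left _ _))
  have h5 : mtlNeg d = ⊥ := by
    rw [← mul_himp_of_le h4, ← mtlNeg_mul, mul_comm _ d, h2, mul_neg_self]
  rw [h5, mtlNeg_bot]

theorem neg_neg_mul_le (a b : A) :
    mtlNeg (mtlNeg a) * mtlNeg (mtlNeg b) ≤ mtlNeg (mtlNeg (a * b)) := by
  rw [le_neg_comm, mtlNeg_mul, mtlNeg_mul, neg_neg_neg, himp_neg_neg]

theorem neg_neg_himp (a b : A) :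
    mtlNeg (mtlNeg (a ⇨ b)) = mtlNeg (mtlNeg a) ⇨ mtlNeg (mtlNeg b) := by
  rw [himp_neg_neg]
  apply le_antisymm
  · rw [le_himp_iff_mul_le]
    refine (mul_le_mul_right (le_neg_neg a) _).trans ((neg_neg_mul_le _ _).trans ?_)
    exact neg_anti (neg_anti (himp_mul_le a b))
  -- The second factor is dense, so it disappears under double negation.
  · have h : (a ⇨ mtlNeg (mtlNeg b)) * (mtlNeg (mtlNeg b) ⇨ b) ≤ a ⇨ b := by
      rw [le_himp_iff_mul_le, mul_right_comm]
      exact (mul_le_mul_left (himp_mul_le _ _) _).trans (mul_himp_le _ _)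
    have h' := (neg_neg_mul_le _ _).trans (neg_anti (neg_anti h))
    rw [neg_neg_himp_self_dense, mul_one] at h'
    exact (le_neg_neg _).trans h'

theorem neg_neg_mul (a b : A) :
    mtlNeg (mtlNeg (a * b)) = mtlNeg (mtlNeg (mtlNeg (mtlNeg a) * mtlNeg (mtlNeg b))) := by
  rw [mtlNeg_mul (mtlNeg (mtlNeg a)), mtlNeg_mul, neg_neg_neg, himp_neg_neg]

theorem neg_neg_inf (a b : A) :
    mtlNeg (mtlNeg (a ⊓ b)) =
      mtlNeg (mtlNeg (mtlNeg (mtlNeg a) * (mtlNeg (mtlNeg a) ⇨ mtlNeg (mtlNeg b)))) := by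
  rw [divisible, neg_neg_mul, neg_neg_himp]

/-- Glivenko principle: double negation is compatible with every operation. -/
theorem neg_neg_eval {X : Type v} {e e' : X → A}
    (h : ∀ x, mtlNeg (mtlNeg (e x)) = mtlNeg (mtlNeg (e' x))) (t : MTLTerm X) :
    mtlNeg (mtlNeg (t.eval e)) = mtlNeg (mtlNeg (t.eval e')) := by
  induction t with
  | var x => exact h x
  | bot => rfl
  | one => rfl
  | mul s t hs ht => simp only [MTLTerm.eval]; rw [neg_neg_mul, hs, ht, ← neg_neg_mul]
  | imp s t hs ht => simp only [MTLTerm.eval]; rw [neg_neg_himp, hs, ht, ← neg_neg_himp]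
  | inf s t hs ht => simp only [MTLTerm.eval]; rw [neg_neg_inf, hs, ht, ← neg_neg_inf]
  | sup s t hs ht =>
    simp only [MTLTerm.eval]
    rw [mtlNeg_sup, mtlNeg_sup, ← neg_neg_neg (s.eval e), ← neg_neg_neg (t.eval e), hs, ht,
      neg_neg_neg, neg_neg_neg]

/-- A BL-algebra in which a unary term defines `Δ` is an MV-algebra. -/
theorem isMVAlgebra_of_isDelta_eval {t : MTLTerm Unit}
    (ht : IsDelta fun a : A => t.eval fun _ => a) : IsMVAlgebra A := by
  have key : ∀ x : A, mtlNeg (mtlNeg x) = 1 → x = 1 := fun x hx => by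
    have h := neg_neg_eval (e := fun _ => x) (e' := fun _ => 1)
      (fun _ => by rw [hx, mtlNeg_one, mtlNeg_bot]) t
    have h1 : t.eval (fun _ => (1 : A)) = 1 := ht.necessitation
    have h2 : mtlNeg (mtlNeg (t.eval fun _ => x)) = t.eval fun _ => x :=
      neg_neg_eq_of_sup_neg (ht.excluded_middle x)
    rw [h2, h1, mtlNeg_one, mtlNeg_bot] at h
    exact eq_one_of_le (h ▸ ht.le x)
  intro a
  exact le_antisymm (himp_eq_one.1 (key _ (neg_neg_himp_self_dense a))) (le_neg_neg a)

end BLAlgebra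

/-! ### MV-algebras and the size of MV-chains -/

namespace IsMVAlgebra

open MTLAlgebra BLAlgebra

variable {A : Type u} [BLAlgebra A]

theorem mul_eq (hA : IsMVAlgebra A) (a b : A) : a * b = mtlNeg (a ⇨ mtlNeg b) := by
  rw [← mtlNeg_mul, hA]

theorem neg_himp_neg (hA : IsMVAlgebra A) (a b : A) : mtlNeg a ⇨ mtlNeg b = b ⇨ a := by
  rw [← mtlNeg_mul, mul_comm, mtlNeg_mul, hA]

theorem himp_himp (hA : IsMVAlgebra A) (a b : A) : (a ⇨ b) ⇨ b = a ⊔ b := by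
  rw [← hA.neg_himp_neg b (a ⇨ b), ← hA.neg_himp_neg b a, ← mtlNeg_mul, ← divisible, inf_comm,
    ← mtlNeg_sup, hA]

theorem himp_mul_self (hA : IsMVAlgebra A) (a b : A) : a ⇨ a * b = mtlNeg a ⊔ b := by
  rw [← hA.neg_himp_neg, mul_comm, mtlNeg_mul, hA.himp_himp, sup_comm]

end IsMVAlgebra

namespace IsMVChain

open MTLAlgebra BLAlgebra

variable {A : Type u} [BLAlgebra A]

theorem eq_bot_or_eq_one_of_mul_eq_self (hA : IsMVChain A) {a b : A} (h : a * b = a) :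
    a = ⊥ ∨ b = 1 := by
  have h1 := hA.1.himp_mul_self a b
  rw [h, himp_eq_one.2 le_rfl] at h1
  exact (eq_one_or_of_sup hA.2 h1.symm).imp_left eq_bot_of_neg_eq_one

theorem neg_le_of_mul_ne_bot (hA : IsMVChain A) {a b : A} (h : a * b ≠ ⊥) : mtlNeg a ≤ b := by
  rcases hA.2 (mtlNeg a) b with h' | h'
  · exact h'
  · exact absurd (by rw [mul_comm]; exact le_neg_iff.1 h') h

/-- MV-chains are cancellative as long as products stay above `⊥`; truncated subtraction covers the
case `n ≤ m`. -/
theorem pow_himp_pow (hA : IsMVChain A) {a : A} {m n N : ℕ} (h : a ^ N ≠ ⊥) (hn : n ≤ N) :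
    a ^ m ⇨ a ^ n = a ^ (n - m) := by
  rcases le_total n m with hnm | hmn
  · rw [Nat.sub_eq_zero_of_le hnm, pow_zero, himp_eq_one]
    exact pow_antitone a hnm
  · obtain ⟨k, rfl⟩ := Nat.exists_eq_add_of_le hmn
    rw [Nat.add_sub_cancel_left, pow_add, hA.1.himp_mul_self, sup_eq_right]
    exact hA.neg_le_of_mul_ne_bot (by rw [← pow_add]; exact pow_ne_bot_of_le h hn)

/-- In an MV-chain with `N` elements, the `N`-th power of an element below `1` vanishes. -/
theorem pow_card_eq_bot (hA : IsMVChain A) [Finite A] {a : A} (ha : a ≠ 1) {n : ℕ}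
    (hn : Nat.card A ≤ n) : a ^ n = ⊥ := by
  have := Fintype.ofFinite A
  obtain ⟨i, j, hij, h⟩ := Fintype.exists_ne_map_eq_of_card_lt
    (fun i : Fin (Nat.card A + 1) => a ^ (i : ℕ)) (by simp)
  wlog hlt : i < j generalizing i j
  · exact this j i hij.symm h.symm (lt_of_le_of_ne (not_lt.1 hlt) hij.symm)
  have hlt' : (i : ℕ) < j := hlt
  obtain ⟨k, hk⟩ := Nat.exists_eq_add_of_lt hlt'
  -- The repeated power reads `a ^ i = a ^ i * a ^ (k + 1)`, so `a ^ i = ⊥` or `a ^ (k + 1) = 1`;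
  -- the latter would force `a = 1`.
  rw [hk, add_assoc, pow_add] at h
  rcases hA.eq_bot_or_eq_one_of_mul_eq_self h.symm with h' | h'
  · exact le_bot_iff.1 (h' ▸ pow_antitone a (by omega))
  · refine absurd (eq_one_of_le ?_) ha
    rw [← h', pow_succ]
    exact mul_le_right _ _

theorem isDelta_pow (hA : IsMVChain A) {n : ℕ} (h : ∀ a : A, a ≠ 1 → a ^ n = ⊥) :
    IsDelta fun a : A => a ^ n := by
  have hp : ∀ a : A, a = 1 ∨ a ^ n = ⊥ := fun a => (eq_or_ne a 1).imp_right (h a)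
  constructor
  · intro a
    rcases hp a with rfl | h'
    · exact eq_one_of_le (by simp)
    · simp only [h']
      exact eq_one_of_le (by rw [mtlNeg_bot]; exact le_sup_right)
  · intro a
    rw [himp_eq_one]
    rcases hp a with rfl | h'
    · exact le_unit _
    · simp only [h', bot_le]
  · intro a
    rw [himp_eq_one]
    rcases hp a with rfl | h'
    · simp
    · simp only [h', bot_le]
  · intro a b
    rw [himp_eq_one, le_himp_iff_mul_le]
    simp only [← mul_pow]
    exact pow_le_pow_left' (himp_mul_le a b) n
  · intro a b
    rw [himp_eq_one]
    rcases hA.2 a b with h' | h'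
    · rw [sup_eq_right.2 h']; exact le_sup_right
    · rw [sup_eq_left.2 h']; exact le_sup_left
  · exact one_pow n

theorem exists_ne_one_upper_bound (hA : IsMVChain A) (hbot : (⊥ : A) ≠ 1) (S : Finset A)
    (hS : ∀ a ∈ S, a ≠ 1) : ∃ d : A, d ≠ 1 ∧ ∀ a ∈ S, a ≤ d := by
  classical
  induction S using Finset.induction_on with
  | empty => exact ⟨⊥, hbot, by simp⟩
  | insert a S _ ih =>
    obtain ⟨d, hd, h⟩ := ih fun b hb => hS b (Finset.mem_insert_of_mem hb)
    rcases hA.2 a d with had | hda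
    · refine ⟨d, hd, fun b hb => ?_⟩
      rcases Finset.mem_insert.1 hb with rfl | hb
      exacts [had, h b hb]
    · refine ⟨a, hS a (Finset.mem_insert_self _ _), fun b hb => ?_⟩
      rcases Finset.mem_insert.1 hb with rfl | hb
      exacts [le_rfl, (h b hb).trans hda]

/-- Take `d ≠ 1` above all residua `b ⇨ a ≠ 1` with `a`, `b` in `S`. If `a < b` in `S`, then `a = b
* (b ⇨ a) ≤ b * d`, so each step down in `S` costs a further factor `d`. Since `d ^ N = ⊥`, the
powers of `d` grade `S` injectively by `0, …, N`. -/
theorem finset_card_le (hA : IsMVChain A) {N : ℕ} (h : ∀ a : A, a ≠ 1 → a ^ N = ⊥)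
    (S : Finset A) : S.card ≤ N + 1 := by
  classical
  by_cases hbot : (⊥ : A) = 1
  · have : Subsingleton A := ⟨fun a b => by
      rw [eq_one_of_le (hbot ▸ bot_le : (1 : A) ≤ a), eq_one_of_le (hbot ▸ bot_le : (1 : A) ≤ b)]⟩
    exact (Finset.card_le_one_of_subsingleton S).trans (by omega)
  obtain ⟨d, hd, hdS⟩ := hA.exists_ne_one_upper_bound hbot
    (((S ×ˢ S).filter fun p => ¬ p.1 ≤ p.2).image fun p => p.1 ⇨ p.2) (by
      simp only [Finset.mem_image, Finset.mem_filter]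
      rintro _ ⟨p, ⟨_, hp⟩, rfl⟩ h1
      exact hp (himp_eq_one.1 h1))
  set f : A → ℕ := fun a => Nat.findGreatest (fun k => a ≤ d ^ k) N with hf
  have hfle : ∀ a, a ≤ d ^ f a := fun a =>
    Nat.findGreatest_spec (P := fun k => a ≤ d ^ k) (Nat.zero_le N) (by simpa using le_unit a)
  have hlt : ∀ a ∈ S, ∀ b ∈ S, ¬ b ≤ a → f b < f a := fun a ha b hb hab => by
    have h1 : b ⇨ a ≤ d := hdS _ (Finset.mem_image.2
      ⟨(b, a), Finset.mem_filter.2 ⟨Finset.mem_product.2 ⟨hb, ha⟩, hab⟩, rfl⟩)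
    have hle : a ≤ b := (hA.2 a b).resolve_right hab
    have h2 : a ≤ d ^ (f b + 1) := by
      rw [pow_succ, ← mul_himp_of_le hle]
      exact mul_le_mul' (hfle b) h1
    have h3 : f b < N := by
      refine lt_of_le_of_ne (Nat.findGreatest_le N) fun h4 => hab ?_
      have h5 := hfle b
      rw [h4, h d hd] at h5
      exact h5.trans bot_le
    exact Nat.le_findGreatest (P := fun k => a ≤ d ^ k) h3 h2
  rw [← Finset.card_range (N + 1)]
  refine Finset.card_le_card_of_injOn f (fun a _ => ?_) fun a ha b hb hab => ?_
  · simpa [Nat.lt_succ_iff] using Nat.findGreatest_le N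
  · by_contra hne
    rcases hA.2 a b with hle | hle
    · exact (hlt a ha b hb fun h' => hne (le_antisymm hle h')).ne hab.symm
    · exact (hlt b hb a ha fun h' => hne (le_antisymm h' hle)).ne hab

theorem finite_and_card_le (hA : IsMVChain A) {N : ℕ} (h : ∀ a : A, a ≠ 1 → a ^ N = ⊥) :
    Finite A ∧ Nat.card A ≤ N + 1 := by
  have hfin : Finite A := by
    by_contra hinf
    rw [not_finite_iff_infinite] at hinf
    obtain ⟨S, hS⟩ := Infinite.exists_subset_card_eq A (N + 2)
    have := hA.finset_card_le h S
    omega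
  have := Fintype.ofFinite A
  exact ⟨hfin, by rw [Nat.card_eq_fintype_card]; exact hA.finset_card_le h Finset.univ⟩

end IsMVChain

/-! ### Germs at `1` of unary terms -/

/-- The functions that the unary terms induce near `1` on MV-chains: powers and their
negations. -/
def powGerm {A : Type u} [BLAlgebra A] (s : Bool) (k : ℕ) (a : A) : A :=
  if s then a ^ k else mtlNeg (a ^ k)

/-- A family of unary functions on BL-algebras agrees on all MV-chains with one `powGerm`,
on the elements whose `N`-th power does not vanish. -/
def HasPowGerm (f : ∀ A : BLAlg.{u}, A.carrier → A.carrier) : Prop :=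
  ∃ (s : Bool) (k N : ℕ), ∀ A : BLAlg.{u}, IsMVChain A.carrier →
    ∀ a : A.carrier, a ^ N ≠ ⊥ → f A a = powGerm s k a

namespace HasPowGerm

open MTLAlgebra BLAlgebra

variable {f g : ∀ A : BLAlg.{u}, A.carrier → A.carrier}

theorem congr (hf : HasPowGerm f)
    (h : ∀ A : BLAlg.{u}, IsMVChain A.carrier → ∀ a, g A a = f A a) : HasPowGerm g := by
  obtain ⟨s, k, N, hf⟩ := hf
  exact ⟨s, k, N, fun A hA a ha => (h A hA a).trans (hf A hA a ha)⟩

theorem exists_powGerm_himp (s s' : Bool) (k k' : ℕ) : ∃ (s'' : Bool) (k'' : ℕ),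
    ∀ A : BLAlg.{u}, IsMVChain A.carrier → ∀ a : A.carrier, a ^ (k + k') ≠ ⊥ →
      powGerm s k a ⇨ powGerm s' k' a = powGerm s'' k'' a := by
  cases s <;> cases s'
  · exact ⟨true, k - k', fun A hA a ha => by
      simpa [powGerm, hA.1.neg_himp_neg] using hA.pow_himp_pow ha (by omega)⟩
  · exact ⟨true, 0, fun A hA a ha => by
      simpa [powGerm, himp_eq_one] using hA.neg_le_of_mul_ne_bot (by rwa [← pow_add])⟩
  · exact ⟨false, k + k', fun A hA a ha => by simp [powGerm, pow_add, mtlNeg_mul]⟩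
  · exact ⟨true, k' - k, fun A hA a ha => by
      simpa [powGerm] using hA.pow_himp_pow ha (by omega)⟩

theorem himp (hf : HasPowGerm f) (hg : HasPowGerm g) :
    HasPowGerm fun A a => f A a ⇨ g A a := by
  obtain ⟨s, k, N, hf⟩ := hf
  obtain ⟨s', k', N', hg⟩ := hg
  obtain ⟨s'', k'', h⟩ := exists_powGerm_himp.{u} s s' k k'
  refine ⟨s'', k'', N + N' + (k + k'), fun A hA a ha => ?_⟩
  simp only [hf A hA a (pow_ne_bot_of_le ha (by omega)),
    hg A hA a (pow_ne_bot_of_le ha (by omega))]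
  exact h A hA a (pow_ne_bot_of_le ha (by omega))

theorem bot : HasPowGerm.{u} fun _ _ => ⊥ :=
  ⟨false, 0, 0, fun A _ a _ => by simp [powGerm, mtlNeg_one]⟩

theorem neg (hf : HasPowGerm f) : HasPowGerm fun A a => mtlNeg (f A a) := hf.himp bot

theorem mul (hf : HasPowGerm f) (hg : HasPowGerm g) : HasPowGerm fun A a => f A a * g A a :=
  (hf.himp hg.neg).neg.congr fun _ hA _ => hA.1.mul_eq _ _

/-- On MV-chains all operations reduce to `⇨` and `⊥`, so closure of germs under `⇨` suffices. -/
theorem eval (t : MTLTerm Unit) :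
    HasPowGerm.{u} fun _ a => t.eval fun _ => a := by
  induction t with
  | var x => exact ⟨true, 1, 0, fun A _ a _ => by simp [powGerm, MTLTerm.eval]⟩
  | bot => exact bot
  | one => exact ⟨true, 0, 0, fun A _ a _ => by simp [powGerm, MTLTerm.eval]⟩
  | mul s t hs ht => exact hs.mul ht
  | imp s t hs ht => exact hs.himp ht
  | inf s t hs ht => exact (hs.mul (hs.himp ht)).congr fun _ _ _ => divisible _ _
  | sup s t hs ht =>
    exact ((hs.himp ht).himp ht).congr fun _ hA _ => (hA.1.himp_himp _ _).symm

end HasPowGerm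

open MTLAlgebra in
/-- If `t` defines `Δ` on a class of MV-chains, then these chains have bounded nilpotency
order. -/
theorem exists_pow_eq_bot_of_isDelta_eval (t : MTLTerm Unit) : ∃ N : ℕ, ∀ A : BLAlg.{u},
    IsMVChain A.carrier → (IsDelta fun a : A.carrier => t.eval fun _ => a) →
      ∀ a : A.carrier, a ≠ 1 → a ^ N = ⊥ := by
  obtain ⟨s, k, N, h⟩ := HasPowGerm.eval.{u} t
  -- `a ^ (N + k) ≠ ⊥` puts `a` in the range of the germ and also keeps `a ^ k` nonzero.
  refine ⟨N + k, fun A hA ht a ha => ?_⟩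
  by_contra hne
  have h0 : (⊥ : A.carrier) ≠ 1 := fun h0 => hne (le_bot_iff.1 (h0 ▸ le_unit _))
  have h1 : t.eval (fun _ => (1 : A.carrier)) = _ := h A hA 1 (by rw [one_pow]; exact h0.symm)
  have h2 : t.eval (fun _ => a) = _ := h A hA a (pow_ne_bot_of_le hne (by omega))
  have h3 : t.eval (fun _ => (1 : A.carrier)) = 1 := ht.necessitation
  have h4 : t.eval (fun _ => a) = ⊥ := ht.eq_bot_of_ne_one hA.2 ha
  -- A negated power would take the value `⊥` at `1`; a plain power would be nonzero at `a`.
  cases s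
  · rw [h3] at h1
    simp [powGerm, mtlNeg_one] at h1
    exact h0 h1.symm
  · rw [h4] at h2
    exact pow_ne_bot_of_le hne (Nat.le_add_left k N) (by simpa [powGerm] using h2.symm)

/-! ### Filters, quotients and separation by chains -/

section

open MTLAlgebra

variable {A : Type u}

/-- Deductive filters of an MTL-algebra. -/
structure IsDeductiveFilter [MTLAlgebra A] (F : Set A) : Prop where
  one_mem : 1 ∈ F
  mem_of_le : ∀ {a b}, a ∈ F → a ≤ b → b ∈ F
  mul_mem : ∀ {a b}, a ∈ F → b ∈ F → a * b ∈ F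

namespace IsDeductiveFilter

section MTL

variable [MTLAlgebra A] {F : Set A}

theorem mem_of_mul_le (hF : IsDeductiveFilter F) {a b c : A} (ha : a ∈ F) (hb : b ∈ F)
    (h : a * b ≤ c) : c ∈ F :=
  hF.mem_of_le (hF.mul_mem ha hb) h

theorem himp_mem_of_le (hF : IsDeductiveFilter F) {a b : A} (h : a ≤ b) : a ⇨ b ∈ F := by
  rw [himp_eq_one.2 h]; exact hF.one_mem

/-- The filter generated by `F` and `a`. -/
theorem adjoin (hF : IsDeductiveFilter F) (a : A) :
    IsDeductiveFilter {b | ∃ f ∈ F, ∃ n : ℕ, f * a ^ n ≤ b} where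
  one_mem := ⟨1, hF.one_mem, 0, le_unit _⟩
  mem_of_le := by
    rintro b c ⟨f, hf, n, h⟩ hbc
    exact ⟨f, hf, n, h.trans hbc⟩
  mul_mem := by
    rintro b c ⟨f, hf, n, h⟩ ⟨g, hg, m, h'⟩
    refine ⟨f * g, hF.mul_mem hf hg, n + m, ?_⟩
    rw [pow_add, mul_mul_mul_comm]
    exact mul_le_mul' h h'

/-- Elements other than `1` are avoided by a prime filter. -/
theorem exists_prime {a : A} (ha : a ≠ 1) : ∃ F : Set A, IsDeductiveFilter F ∧ a ∉ F ∧
    ∀ x y : A, x ⇨ y ∈ F ∨ y ⇨ x ∈ F := by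
  obtain ⟨F, -, hmax⟩ := zorn_subset_nonempty {F : Set A | IsDeductiveFilter F ∧ a ∉ F} (by
    rintro c hc hchain ⟨G₀, hG₀⟩
    refine ⟨⋃₀ c, ⟨⟨⟨G₀, hG₀, (hc hG₀).1.one_mem⟩, ?_, ?_⟩, ?_⟩, fun _ => Set.subset_sUnion_of_mem⟩
    · rintro x y ⟨G, hG, hx⟩ hxy
      exact ⟨G, hG, (hc hG).1.mem_of_le hx hxy⟩
    · rintro x y ⟨G, hG, hx⟩ ⟨G', hG', hy⟩
      rcases hchain.total hG hG' with h | h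
      · exact ⟨G', hG', (hc hG').1.mul_mem (h hx) hy⟩
      · exact ⟨G, hG, (hc hG).1.mul_mem hx (h hy)⟩
    · rintro ⟨G, hG, h⟩
      exact (hc hG).2 h) {1}
    ⟨⟨rfl, fun {x y} hx hxy => eq_one_of_le (Set.mem_singleton_iff.1 hx ▸ hxy), fun {x y} hx hy => by
      rw [Set.mem_singleton_iff.1 hx, Set.mem_singleton_iff.1 hy, one_mul]; rfl⟩, ha⟩
  obtain ⟨hF, haF⟩ := hmax.prop
  refine ⟨F, hF, haF, fun x y => ?_⟩
  -- By maximality, the filter generated by `F` and `z` must contain `a`.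
  have key : ∀ z : A, z ∉ F → ∃ f ∈ F, ∃ n : ℕ, f * z ^ n ≤ a := fun z hz => by
    by_contra hcon
    refine hz (hmax.le_of_ge ⟨hF.adjoin z, hcon⟩ (fun f hf => ⟨f, hf, 0, by simp⟩) ?_)
    exact ⟨1, hF.one_mem, 1, by simp⟩
  by_contra hcon
  rw [not_or] at hcon
  obtain ⟨f, hf, n, h⟩ := key _ hcon.1
  obtain ⟨g, hg, m, h'⟩ := key _ hcon.2
  refine haF (hF.mem_of_le (hF.mul_mem hf hg) ?_)
  calc f * g = f * g * ((x ⇨ y) ^ n ⊔ (y ⇨ x) ^ m) := by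
        rw [pow_sup_pow_eq_one (prelinear x y), mul_one]
    _ ≤ a := mul_sup_le
      ((mul_le_mul_left (mul_le_left f g) _).trans h)
      ((mul_le_mul_left (mul_le_right f g) _).trans h')

theorem himp_trans_mem (hF : IsDeductiveFilter F) {a b c : A} (h : a ⇨ b ∈ F) (h' : b ⇨ c ∈ F) :
    a ⇨ c ∈ F := by
  refine hF.mem_of_mul_le h h' ?_
  rw [le_himp_iff_mul_le, mul_right_comm]
  exact (mul_le_mul_left (himp_mul_le _ _) _).trans (mul_himp_le _ _)

/-- The congruence of a filter. -/
def setoid (hF : IsDeductiveFilter F) : Setoid A where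
  r a b := a ⇨ b ∈ F ∧ b ⇨ a ∈ F
  iseqv :=
    { refl := fun _ => ⟨hF.himp_mem_of_le le_rfl, hF.himp_mem_of_le le_rfl⟩
      symm := fun h => h.symm
      trans := fun h h' => ⟨hF.himp_trans_mem h.1 h'.1, hF.himp_trans_mem h'.2 h.2⟩ }

theorem mul_himp_mul_mem (hF : IsDeductiveFilter F) {a b c d : A} (h : a ⇨ b ∈ F)
    (h' : c ⇨ d ∈ F) : a * c ⇨ b * d ∈ F := by
  refine hF.mem_of_mul_le h h' ?_
  rw [le_himp_iff_mul_le, mul_mul_mul_comm]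
  exact mul_le_mul' (himp_mul_le _ _) (himp_mul_le _ _)

theorem himp_himp_himp_mem (hF : IsDeductiveFilter F) {a b c d : A} (h : b ⇨ a ∈ F)
    (h' : c ⇨ d ∈ F) : (a ⇨ c) ⇨ (b ⇨ d) ∈ F := by
  refine hF.mem_of_mul_le h h' ?_
  rw [le_himp_iff_mul_le, le_himp_iff_mul_le]
  calc (b ⇨ a) * (c ⇨ d) * (a ⇨ c) * b = (c ⇨ d) * ((a ⇨ c) * ((b ⇨ a) * b)) := by ac_rfl
    _ ≤ (c ⇨ d) * ((a ⇨ c) * a) := by gcongr; exact himp_mul_le _ _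
    _ ≤ (c ⇨ d) * c := by gcongr; exact himp_mul_le _ _
    _ ≤ d := himp_mul_le _ _

theorem himp_inf_mem (hF : IsDeductiveFilter F) {a b c : A} (h : a ⇨ b ∈ F) (h' : a ⇨ c ∈ F) :
    a ⇨ b ⊓ c ∈ F := by
  refine hF.mem_of_mul_le h h' ?_
  rw [le_himp_iff_mul_le]
  exact le_inf ((mul_le_mul_left (mul_le_left _ _) _).trans (himp_mul_le _ _))
    ((mul_le_mul_left (mul_le_right _ _) _).trans (himp_mul_le _ _))

theorem sup_himp_mem (hF : IsDeductiveFilter F) {a b c : A} (h : a ⇨ c ∈ F) (h' : b ⇨ c ∈ F) :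
    a ⊔ b ⇨ c ∈ F := by
  refine hF.mem_of_mul_le h h' ?_
  rw [le_himp_iff_mul_le]
  exact mul_sup_le ((mul_le_mul_left (mul_le_left _ _) _).trans (himp_mul_le _ _))
    ((mul_le_mul_left (mul_le_right _ _) _).trans (himp_mul_le _ _))

theorem inf_himp_inf_mem (hF : IsDeductiveFilter F) {a b c d : A} (h : a ⇨ b ∈ F)
    (h' : c ⇨ d ∈ F) : a ⊓ c ⇨ b ⊓ d ∈ F :=
  hF.himp_inf_mem (hF.himp_trans_mem (hF.himp_mem_of_le inf_le_left) h)
    (hF.himp_trans_mem (hF.himp_mem_of_le inf_le_right) h')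

theorem sup_himp_sup_mem (hF : IsDeductiveFilter F) {a b c d : A} (h : a ⇨ b ∈ F)
    (h' : c ⇨ d ∈ F) : a ⊔ c ⇨ b ⊔ d ∈ F :=
  hF.sup_himp_mem (hF.himp_trans_mem h (hF.himp_mem_of_le le_sup_left))
    (hF.himp_trans_mem h' (hF.himp_mem_of_le le_sup_right))

/-- The carrier of the quotient of an MTL-algebra by a filter. It is not reducible: `Quotient`
carries an order of its own. -/
def QuotientCarrier (hF : IsDeductiveFilter F) : Type u :=
  Quotient hF.setoid

end MTL

variable [BLAlgebra A] {F : Set A}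

/-- The order on the quotient by a filter. -/
abbrev quotientPartialOrder (hF : IsDeductiveFilter F) : PartialOrder hF.QuotientCarrier where
  le := Quotient.lift₂ (fun a b => a ⇨ b ∈ F) fun _ _ _ _ h h' => propext
    ⟨fun H => hF.himp_trans_mem h.2 (hF.himp_trans_mem H h'.1),
      fun H => hF.himp_trans_mem h.1 (hF.himp_trans_mem H h'.2)⟩
  le_refl := by
    rintro ⟨a⟩
    exact hF.himp_mem_of_le le_rfl
  le_trans := by
    rintro ⟨a⟩ ⟨b⟩ ⟨c⟩ h h'
    exact hF.himp_trans_mem h h'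
  le_antisymm := by
    rintro ⟨a⟩ ⟨b⟩ h h'
    exact Quotient.sound ⟨h, h'⟩

/-- The quotient of a BL-algebra by a filter. -/
abbrev quotientBLAlgebra (hF : IsDeductiveFilter F) : BLAlgebra hF.QuotientCarrier where
  __ := hF.quotientPartialOrder
  inf := Quotient.map₂ (· ⊓ ·) fun _ _ h _ _ h' =>
    ⟨hF.inf_himp_inf_mem h.1 h'.1, hF.inf_himp_inf_mem h.2 h'.2⟩
  sup := Quotient.map₂ (· ⊔ ·) fun _ _ h _ _ h' =>
    ⟨hF.sup_himp_sup_mem h.1 h'.1, hF.sup_himp_sup_mem h.2 h'.2⟩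
  inf_le_left := by
    rintro ⟨a⟩ ⟨b⟩
    exact hF.himp_mem_of_le inf_le_left
  inf_le_right := by
    rintro ⟨a⟩ ⟨b⟩
    exact hF.himp_mem_of_le inf_le_right
  le_inf := by
    rintro ⟨a⟩ ⟨b⟩ ⟨c⟩ h h'
    exact hF.himp_inf_mem h h'
  le_sup_left := by
    rintro ⟨a⟩ ⟨b⟩
    exact hF.himp_mem_of_le le_sup_left
  le_sup_right := by
    rintro ⟨a⟩ ⟨b⟩
    exact hF.himp_mem_of_le le_sup_right
  sup_le := by
    rintro ⟨a⟩ ⟨b⟩ ⟨c⟩ h h'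
    exact hF.sup_himp_mem h h'
  bot := Quotient.mk _ ⊥
  bot_le := by
    rintro ⟨a⟩
    exact hF.himp_mem_of_le bot_le
  one := Quotient.mk _ 1
  mul := Quotient.map₂ (· * ·) fun _ _ h _ _ h' =>
    ⟨hF.mul_himp_mul_mem h.1 h'.1, hF.mul_himp_mul_mem h.2 h'.2⟩
  mul_assoc := by
    rintro ⟨a⟩ ⟨b⟩ ⟨c⟩
    exact congrArg (Quotient.mk _) (mul_assoc a b c)
  mul_comm := by
    rintro ⟨a⟩ ⟨b⟩
    exact congrArg (Quotient.mk _) (mul_comm a b)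
  one_mul := by
    rintro ⟨a⟩
    exact congrArg (Quotient.mk _) (one_mul a)
  mul_one := by
    rintro ⟨a⟩
    exact congrArg (Quotient.mk _) (mul_one a)
  himp := Quotient.map₂ (· ⇨ ·) fun _ _ h _ _ h' =>
    ⟨hF.himp_himp_himp_mem h.2 h'.1, hF.himp_himp_himp_mem h.1 h'.2⟩
  le_unit := by
    rintro ⟨a⟩
    exact hF.himp_mem_of_le (le_unit a)
  residuation := by
    rintro ⟨a⟩ ⟨b⟩ ⟨c⟩
    exact iff_of_eq (congrArg (· ∈ F) (mul_himp a b c))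
  prelinear := by
    rintro ⟨a⟩ ⟨b⟩
    exact congrArg (Quotient.mk _) (prelinear a b)
  divisible := by
    rintro ⟨a⟩ ⟨b⟩
    exact congrArg (Quotient.mk _) (BLAlgebra.divisible a b)

end IsDeductiveFilter

/-- Homomorphisms of MTL-algebras. -/
structure IsMTLHom {A B : Type*} [MTLAlgebra A] [MTLAlgebra B] (f : A → B) : Prop where
  map_bot : f ⊥ = ⊥
  map_one : f 1 = 1
  map_mul : ∀ a b, f (a * b) = f a * f b
  map_himp : ∀ a b, f (a ⇨ b) = f a ⇨ f b
  map_inf : ∀ a b, f (a ⊓ b) = f a ⊓ f b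
  map_sup : ∀ a b, f (a ⊔ b) = f a ⊔ f b

theorem IsMTLHom.map_eval {A B : Type*} [MTLAlgebra A] [MTLAlgebra B] {f : A → B}
    (hf : IsMTLHom f) {X : Type v} (e : X → A) (t : MTLTerm X) :
    f (t.eval e) = t.eval fun x => f (e x) := by
  induction t with
  | var x => rfl
  | bot => exact hf.map_bot
  | one => exact hf.map_one
  | mul s t hs ht => simp only [MTLTerm.eval, hf.map_mul, hs, ht]
  | imp s t hs ht => simp only [MTLTerm.eval, hf.map_himp, hs, ht]
  | inf s t hs ht => simp only [MTLTerm.eval, hf.map_inf, hs, ht]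
  | sup s t hs ht => simp only [MTLTerm.eval, hf.map_sup, hs, ht]

theorem IsBLVariety.mem_of_surjective {L : Set BLAlg.{u}} (hL : IsBLVariety L) {A B : BLAlg.{u}}
    (hA : A ∈ L) {f : A.carrier → B.carrier} (hf : IsMTLHom f) (hsurj : Function.Surjective f) :
    B ∈ L := by
  obtain ⟨E, rfl⟩ := hL
  intro p hp e
  have h := congrArg f (hA p hp fun n => Function.surjInv hsurj (e n))
  simpa only [hf.map_eval, Function.surjInv_eq hsurj] using h

/-- Distinct elements of a BL-algebra are separated by a chain among its quotients. -/
theorem IsBLVariety.exists_chain_separating {L : Set BLAlg.{u}} (hL : IsBLVariety L)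
    {A : BLAlg.{u}} (hA : A ∈ L) {a b : A.carrier} (hab : a ≠ b) :
    ∃ B ∈ L, (∀ x y : B.carrier, x ≤ y ∨ y ≤ x) ∧
      ∃ f : A.carrier → B.carrier, IsMTLHom f ∧ f a ≠ f b := by
  -- A filter omitting this element does not identify `a` with `b`, and primeness makes the quotient
  -- a chain.
  have hne : (a ⇨ b) ⊓ (b ⇨ a) ≠ 1 := fun h => hab (le_antisymm
    (himp_eq_one.1 (eq_one_of_le (h ▸ inf_le_left)))
    (himp_eq_one.1 (eq_one_of_le (h ▸ inf_le_right))))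
  obtain ⟨F, hF, hnot, hprime⟩ := IsDeductiveFilter.exists_prime hne
  let := hF.quotientBLAlgebra
  have hom : IsMTLHom (B := hF.QuotientCarrier) (Quotient.mk hF.setoid) :=
    ⟨rfl, rfl, fun _ _ => rfl, fun _ _ => rfl, fun _ _ => rfl, fun _ _ => rfl⟩
  refine ⟨⟨hF.QuotientCarrier⟩, hL.mem_of_surjective hA hom Quotient.mk_surjective, ?_,
    Quotient.mk hF.setoid, hom, fun h => hnot ?_⟩
  · rintro ⟨x⟩ ⟨y⟩
    exact hprime x y
  · have h' := Quotient.exact h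
    exact hF.mem_of_mul_le h'.1 h'.2 (le_inf (mul_le_left _ _) (mul_le_right _ _))

end

/-! ### Finitely many generating chains -/

/-- The tables of the operations of an MTL-algebra on a set with `n` elements. -/
abbrev OpTables (n : ℕ) : Type :=
  Fin n × Fin n × (Fin n → Fin n → Fin n) × (Fin n → Fin n → Fin n) × (Fin n → Fin n → Fin n) ×
    (Fin n → Fin n → Fin n)

/-- The operation tables of an algebra with an enumeration. -/
def opTables (A : Type u) [MTLAlgebra A] {n : ℕ} (e : A ≃ Fin n) : OpTables n :=
  (e ⊥, e 1, fun i j => e (e.symm i * e.symm j), fun i j => e (e.symm i ⇨ e.symm j),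
    fun i j => e (e.symm i ⊓ e.symm j), fun i j => e (e.symm i ⊔ e.symm j))

theorem isMTLHom_of_opTables_eq {A B : Type*} [MTLAlgebra A] [MTLAlgebra B] {n : ℕ}
    {e : A ≃ Fin n} {e' : B ≃ Fin n} (h : opTables A e = opTables B e') :
    IsMTLHom fun a => e'.symm (e a) := by
  simp only [opTables, Prod.mk.injEq] at h
  obtain ⟨hbot, hone, hmul, himp, hinf, hsup⟩ := h
  refine ⟨by simp [hbot], by simp [hone], fun a b => ?_, fun a b => ?_, fun a b => ?_,
    fun a b => ?_⟩
  · simpa [Equiv.symm_apply_eq] using congrFun (congrFun hmul (e a)) (e b)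
  · simpa [Equiv.symm_apply_eq] using congrFun (congrFun himp (e a)) (e b)
  · simpa [Equiv.symm_apply_eq] using congrFun (congrFun hinf (e a)) (e b)
  · simpa [Equiv.symm_apply_eq] using congrFun (congrFun hsup (e a)) (e b)

/-- Up to isomorphism, there are finitely many algebras with at most `N` elements. -/
theorem exists_finite_representatives (S : Set BLAlg.{u}) (N : ℕ)
    (hS : ∀ A ∈ S, Finite A.carrier ∧ Nat.card A.carrier ≤ N) :
    ∃ K ⊆ S, K.Finite ∧ ∀ A ∈ S, ∃ B ∈ K, ∃ f : A.carrier → B.carrier,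
      IsMTLHom f ∧ Function.Injective f := by
  classical
  let P : (Σ n : Fin (N + 1), OpTables n) → BLAlg.{u} → Prop := fun σ B =>
    B ∈ S ∧ ∃ e : B.carrier ≃ Fin σ.1, opTables B.carrier e = σ.2
  -- One chosen algebra for each table that is realised in `S`; proof irrelevance makes each piece a
  -- subsingleton.
  refine ⟨⋃ σ, {B | ∃ h : ∃ B, P σ B, B = h.choose}, ?_, ?_, fun A hA => ?_⟩
  · rintro B hB
    obtain ⟨σ, h, rfl⟩ := Set.mem_iUnion.1 hB
    exact h.choose_spec.1
  · refine Set.finite_iUnion fun σ => Set.Subsingleton.finite ?_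
    rintro _ ⟨h, rfl⟩ _ ⟨_, rfl⟩
    rfl
  · obtain ⟨hfin, hcard⟩ := hS A hA
    let e : A.carrier ≃ Fin (Nat.card A.carrier) := Finite.equivFin _
    let σ : Σ n : Fin (N + 1), OpTables n :=
      ⟨⟨Nat.card A.carrier, Nat.lt_succ_of_le hcard⟩, opTables A.carrier e⟩
    have h : ∃ B, P σ B := ⟨A, hA, e, rfl⟩
    obtain ⟨-, e', he'⟩ := h.choose_spec
    exact ⟨h.choose, Set.mem_iUnion.2 ⟨σ, h, rfl⟩, _,
      isMTLHom_of_opTables_eq (e := e) (e' := e') he'.symm, e'.symm.injective.comp e.injective⟩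

/-- A variety is generated by any class of its members into which its chains embed. -/
theorem IsBLVariety.eq_varietyGeneratedBy {L K : Set BLAlg.{u}} (hL : IsBLVariety L) (hK : K ⊆ L)
    (h : ∀ A ∈ L, (∀ x y : A.carrier, x ≤ y ∨ y ≤ x) → ∃ B ∈ K, ∃ f : A.carrier → B.carrier,
      IsMTLHom f ∧ Function.Injective f) : L = varietyGeneratedBy K := by
  refine Set.Subset.antisymm (fun A hA => ?_) (Set.sInter_subset_of_mem ⟨hL, hK⟩)
  rintro _ ⟨⟨E, rfl⟩, hKE⟩ p hp e
  by_contra hne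
  obtain ⟨B, hB, htot, f, hf, hne⟩ := hL.exists_chain_separating hA hne
  obtain ⟨C, hC, g, hg, hinj⟩ := h B hB htot
  refine hne (hinj ?_)
  simp only [hf.map_eval, hg.map_eval]
  exact hKE hC p hp _

/-! ### Power terms and the equivalence -/

/-- Powers of a term. -/
def MTLTerm.pow {X : Type v} (s : MTLTerm X) : ℕ → MTLTerm X
  | 0 => .one
  | n + 1 => .mul (s.pow n) s

theorem MTLTerm.eval_pow {X : Type v} {A : Type u} [MTLAlgebra A] (e : X → A) (s : MTLTerm X)
    (n : ℕ) : (s.pow n).eval e = s.eval e ^ n := by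
  induction n with
  | zero => simp [MTLTerm.pow, MTLTerm.eval]
  | succ n ih => simp [MTLTerm.pow, MTLTerm.eval, ih, pow_succ]

/-- The algebras on which the `n`-th power is a `Δ` operation form a variety. -/
theorem isBLVariety_setOf_isDelta_pow (n : ℕ) :
    IsBLVariety {A : BLAlg.{u} | IsDelta fun a : A.carrier => a ^ n} := by
  let x : MTLTerm ℕ := .var 0
  let y : MTLTerm ℕ := .var 1
  refine ⟨{(.sup (x.pow n) (.imp (x.pow n) .bot), .one), (.imp (x.pow n) x, .one),
    (.imp (x.pow n) ((x.pow n).pow n), .one),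
    (.imp ((MTLTerm.imp x y).pow n) (.imp (x.pow n) (y.pow n)), .one),
    (.imp ((MTLTerm.sup x y).pow n) (.sup (x.pow n) (y.pow n)), .one),
    (MTLTerm.one.pow n, .one)}, ?_⟩
  ext A
  simp only [BLAlg.models, Set.mem_ofPred_eq, Set.mem_insert_iff, Set.mem_singleton_iff,
    forall_eq_or_imp, forall_eq, MTLTerm.eval_pow, MTLTerm.eval, x, y]
  constructor
  · intro h
    exact ⟨fun _ => h.excluded_middle _, fun _ => h.reflexive _, fun _ => h.transitive _,
      fun _ => h.imp _ _, fun _ => h.sup _ _, fun _ => h.necessitation⟩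
  · rintro ⟨h₁, h₂, h₃, h₄, h₅, -⟩
    exact ⟨fun a => h₁ fun _ => a, fun a => h₂ fun _ => a, fun a => h₃ fun _ => a,
      fun a b => h₄ fun i => if i = 0 then a else b, fun a b => h₅ fun i => if i = 0 then a else b,
      one_pow n⟩

/-- Once `t` yields a `Δ` operation, `IsDelta.unique` rules out any other expansion. -/
theorem coincidesWithDelta_iff (L : Set BLAlg.{u}) : CoincidesWithDelta L ↔
    ∃ t : MTLTerm Unit, ∀ A ∈ L, IsDelta fun a : A.carrier => t.eval fun _ => a := by
  refine exists_congr fun t => ⟨fun h A hA => ?_, fun h => ?_⟩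
  · have hmem : (⟨A, fun a => t.eval fun _ => a⟩ : BLAlgWithOp.{u}) ∈ termExpansion t L :=
      ⟨hA, rfl⟩
    rw [← h] at hmem
    exact hmem.2
  · ext ⟨A, δ⟩
    refine and_congr_right fun hA => ⟨fun hδ => IsDelta.unique hδ (h A hA), ?_⟩
    intro hδ
    have := h A hA
    rwa [← hδ] at this

theorem corollary5p4 (L : Set BLAlg.{u}) (hL : IsBLVariety L) :
    CoincidesWithDelta L ↔
      (∀ A ∈ L, IsMVAlgebra A.carrier) ∧
        ∃ K : Set BLAlg.{u}, K.Finite ∧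
          (∀ C ∈ K, Finite C.carrier ∧ IsMVChain C.carrier) ∧
          L = varietyGeneratedBy K := by
  rw [coincidesWithDelta_iff]
  constructor
  · rintro ⟨t, ht⟩
    have hMV : ∀ A ∈ L, IsMVAlgebra A.carrier := fun A hA =>
      BLAlgebra.isMVAlgebra_of_isDelta_eval (ht A hA)
    obtain ⟨N, hN⟩ := exists_pow_eq_bot_of_isDelta_eval.{u} t
    have hfin : ∀ A ∈ {A ∈ L | IsMVChain A.carrier},
        Finite A.carrier ∧ Nat.card A.carrier ≤ N + 1 :=
      fun A hA => hA.2.finite_and_card_le (hN A hA.2 (ht A hA.1))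
    obtain ⟨K, hKsub, hKfin, hK⟩ := exists_finite_representatives _ _ hfin
    refine ⟨hMV, K, hKfin, fun C hC => ⟨(hfin C (hKsub hC)).1, (hKsub hC).2⟩, ?_⟩
    exact hL.eq_varietyGeneratedBy (fun C hC => (hKsub hC).1)
      fun A hA htot => hK A ⟨hA, hMV A hA, htot⟩
  · rintro ⟨-, K, hKfin, hK, hLK⟩
    obtain ⟨n, hn⟩ := (hKfin.image fun C => Nat.card C.carrier).bddAbove
    have hsub : L ⊆ {A : BLAlg.{u} | IsDelta fun a : A.carrier => a ^ n} := by
      rw [hLK]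
      refine Set.sInter_subset_of_mem ⟨isBLVariety_setOf_isDelta_pow n, fun C hC => ?_⟩
      have := (hK C hC).1
      exact (hK C hC).2.isDelta_pow fun a ha =>
        (hK C hC).2.pow_card_eq_bot ha (hn (Set.mem_image_of_mem _ hC))
    refine ⟨(MTLTerm.var ()).pow n, fun A hA => ?_⟩
    have h : IsDelta fun a : A.carrier => a ^ n := hsub hA
    simpa only [MTLTerm.eval_pow, MTLTerm.eval] using h
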